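/- Fix positive integers $I_H,J_H,K_H,I_M,J_M,K_M,L,R$ and real matrices $P_1\in\mathbb{R}^{I_H\times I_M}$, $P_2\in\mathbb{R}^{J_H\times J_M}$, $P_M\in\mathbb{R}^{K_M\times K_H}$, each of full row rank. For a matrix $S$ and a vector $c$ let $S\circ c$ be the third-order tensor with entries $(S\circ c)_{ijk}=S_{ij}c_k$. Let $A_r\in\mathbb{R}^{I_M\times L}$, $B_r\in\mathbb{R}^{J_M\times L}$ ($r=1,\dots,R$) and $C\in\mathbb{R}^{K_H\times R}$ be random matrices whose joint distribution (the distribution of the vector of all their entries) is absolutely continuous with respect to Lebesgue measure; this holds, for example, if they are independent and each has an absolutely continuous distribution. Let the super-resolution image (SRI), the hyperspectral image (HSI) and the multispectral image (MSI) be, respectively, $$\underline{Y}_S=\sum_{r=1}^R (A_rB_r^{\top})\circ C(:,r),\qquad \underline{Y}_H=\sum_{r=1}^R \big(P_1A_r(P_2B_r)^{\top}\big)\circ C(:,r),\qquad \underline{Y}_M=\sum_{r=1}^R (A_rB_r^{\top})\circ P_MC(:,r).$$ Suppose that $I_MJ_M\ge L^2R$, $I_HJ_H\ge LR$, and $$\min\!\left(\left\lfloor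 \tfrac{I_M}{L}\right\rfloor,R\right)+\min\!\left(\left\lfloor \tfrac{J_M}{L}\right\rfloor,R\right)+\min(K_M,R)\ \ge\ 2R+2 .$$ Then, with probability one, the following holds for all $A_r^\star\in\mathbb{R}^{I_M\times L}$, $B_r^\star\in\mathbb{R}^{J_M\times L}$ ($r=1,\dots,R$) and $C^\star\in\mathbb{R}^{K_H\times R}$: if $$\underline{Y}_H=\sum_{r=1}^R \big(P_1A_r^\star(P_2B_r^\star)^{\top}\big)\circ C^\star(:,r)\quad\text{and}\quad \underline{Y}_M=\sum_{r=1}^R (A_r^\star (B_r^\star)^{\top})\circ P_MC^\star(:,r),$$ then $$\underline{Y}_S=\sum_{r=1}^R \big(A_r^\star (B_r^\star)^{\top}\big)\circ C^\star(:,r).$$ -/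

import Mathlib

open MeasureTheory

/-- Real third-order tensors of size `I × J × K`. -/
abbrev Tensor3 (I J K : ℕ) : Type := Fin I → Fin J → Fin K → ℝ

/-- The outer product `S ∘ c` of a matrix and a vector. -/
def outerProduct {I J K : ℕ} (S : Matrix (Fin I) (Fin J) ℝ) (c : Fin K → ℝ) : Tensor3 I J K :=
  fun i j k => S i j * c k

/-- The tensor `∑ r, (A_r B_rᵀ) ∘ C(:, r)` with LL1 factors `A_r`, `B_r` and `C`
(all blocks having the same number `L` of columns). -/
def ll1Tensor {I J K L R : ℕ} (A : Fin R → Matrix (Fin I) (Fin L) ℝ)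
    (B : Fin R → Matrix (Fin J) (Fin L) ℝ) (C : Matrix (Fin K) (Fin R) ℝ) : Tensor3 I J K :=
  ∑ r, outerProduct (A r * (B r).transpose) (fun k => C k r)

/-- `(A, B, C)` is a solution of the coupled LL1 decomposition problem with known degradation
matrices `P₁`, `P₂`, `PM` and data `YH` (the HSI) and `YM` (the MSI). There is no rank
restriction on the unknown blocks. -/
structure IsCoupledLL1Solution {IH JH IM JM KM KH L R : ℕ}
    (P₁ : Matrix (Fin IH) (Fin IM) ℝ) (P₂ : Matrix (Fin JH) (Fin JM) ℝ)
    (PM : Matrix (Fin KM) (Fin KH) ℝ) (YH : Tensor3 IH JH KH) (YM : Tensor3 IM JM KM)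
    (A : Fin R → Matrix (Fin IM) (Fin L) ℝ) (B : Fin R → Matrix (Fin JM) (Fin L) ℝ)
    (C : Matrix (Fin KH) (Fin R) ℝ) : Prop where
  hsi : YH = ll1Tensor (fun r => P₁ * A r) (fun r => P₂ * B r) C
  msi : YM = ll1Tensor A B (PM * C)

/-- The space of all entries of the factors `((A_r)_r, (B_r)_r, C)`. As a product of copies of `ℝ`
it carries the Borel σ-algebra and Lebesgue measure `volume`. -/
abbrev FactorSpace (I J K L R : ℕ) : Type :=
  (Fin R → Fin I → Fin L → ℝ) × (Fin R → Fin J → Fin L → ℝ) × (Fin K → Fin R → ℝ)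

/-- The entries of factors, as a point of the factor space. -/
def factorPoint {I J K L R : ℕ} (A : Fin R → Matrix (Fin I) (Fin L) ℝ)
    (B : Fin R → Matrix (Fin J) (Fin L) ℝ) (C : Matrix (Fin K) (Fin R) ℝ) :
    FactorSpace I J K L R :=
  (fun r i l => A r i l, fun r j l => B r j l, fun k r => C k r)

/-! The MSI alone determines the blocks `A r * (B r)ᵀ` up to permutation and nonzero scaling: this
is a Kruskal-type uniqueness theorem for the LL1 decomposition (`exists_perm_of_block_term_eq`).
Degraded spatially, the true blocks are still linearly independent, so comparing coefficients in the
HSI recovers the columns of `C` with the same permutation and the inverse scalings, which cancel in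
the sum (`ll1Tensor_eq_of_isCoupledLL1Solution`).

For the uniqueness, a functional `φ` applied along the third mode turns both decompositions into
matrix identities. Sylvester's inequality bounds the rank of the true side below, and the number of
active terms bounds the other side above. Kruskal's permutation lemma (`exists_perm_smul_eq`) then
matches the third factors, and `block_eq_of_sum_smul_eq` matches the blocks.

The Kruskal ranks and the independence required are generic: each holds at one point and depends
analytically on the entries, hence holds almost everywhere. -/

/-! ### Generic nonvanishing and generic linear independence -/

/-- A real-analytic function on a finite-dimensional space that is nonzero somewhere is nonzero
almost everywhere. -/
theorem ae_ne_zero_of_analyticOnNhd {E : Type*} [NormedAddCommGroup E] [NormedSpace ℝ E]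
    [FiniteDimensional ℝ E] [MeasurableSpace E] [BorelSpace E] (μ : Measure E) [μ.IsAddHaarMeasure]
    {f : E → ℝ} (hf : AnalyticOnNhd ℝ f Set.univ) {x₀ : E} (hx₀ : f x₀ ≠ 0) :
    ∀ᵐ x ∂μ, f x ≠ 0 := by
  have hcont : Continuous f := continuousOn_univ.1 hf.continuousOn
  have hline : ∀ v : E, ∀ᵐ t : ℝ, f (x₀ + t • v) ≠ 0 := by
    intro v
    have hg : AnalyticOnNhd ℝ (fun t : ℝ => f (x₀ + t • v)) Set.univ := by
      intro t _
      exact (hf (x₀ + t • v) trivial).comp_of_eq (by fun_prop) rfl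
    have h0 : (fun t : ℝ => f (x₀ + t • v)) 0 ≠ 0 := by simpa using hx₀
    have hcd := hg.preimage_zero_mem_codiscrete h0
    have := ae_restrict_le_codiscreteWithin (μ := volume) MeasurableSet.univ hcd
    rw [Measure.restrict_univ] at this
    filter_upwards [this] with t ht
    simpa using ht
  have hmeas : MeasurableSet {p : E × ℝ | f (x₀ + p.2 • p.1) ≠ 0} :=
    (isOpen_ne_fun (by fun_prop) continuous_const).measurableSet
  have hprod : ∀ᵐ p ∂(μ.prod (volume : Measure ℝ)), f (x₀ + p.2 • p.1) ≠ 0 :=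
    (Measure.ae_prod_iff_ae_ae hmeas).2 (Filter.Eventually.of_forall hline)
  have hswap : ∀ᵐ t : ℝ, ∀ᵐ v ∂μ, f (x₀ + t • v) ≠ 0 :=
    Measure.ae_ae_comm hmeas |>.1 (Measure.ae_ae_of_ae_prod hprod)
  -- Zeros on each line through `x₀` form a null set of parameters. By Fubini a single `t ≠ 0` works
  -- for almost every direction, and `v ↦ x₀ + t • v` only rescales Haar measure.
  obtain ⟨t, ht, ht0⟩ := (hswap.and (Measure.ae_ne volume (0 : ℝ))).exists
  rw [ae_iff] at ht ⊢
  have hset : {v | ¬ f (x₀ + t • v) ≠ 0} = (t • ·) ⁻¹' ((x₀ + ·) ⁻¹' {x | ¬ f x ≠ 0}) := rfl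
  rw [hset, Measure.addHaar_preimage_smul μ ht0, measure_preimage_add] at ht
  refine (mul_eq_zero.1 ht).resolve_left ?_
  simp [ht0]

open Matrix in
/-- An analytic family of finite tuples of vectors that is linearly independent at one point is
linearly independent at almost every point. -/
theorem ae_linearIndependent_of_analyticOnNhd {E : Type*} [NormedAddCommGroup E] [NormedSpace ℝ E]
    [FiniteDimensional ℝ E] [MeasurableSpace E] [BorelSpace E] (μ : Measure E) [μ.IsAddHaarMeasure]
    {ι κ : Type*} [Fintype ι] [Fintype κ] {v : E → ι → κ → ℝ}
    (hv : ∀ i k, AnalyticOnNhd ℝ (fun x => v x i k) Set.univ) {x₀ : E}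
    (hx₀ : LinearIndependent ℝ (v x₀)) : ∀ᵐ x ∂μ, LinearIndependent ℝ (v x) := by
  classical
  obtain ⟨g, hg⟩ := (Matrix.of (v x₀)).vecMulLinear.exists_leftInverse_of_injective
    (LinearMap.ker_eq_bot.2 (Matrix.vecMul_injective_iff.2 hx₀))
  set G : Matrix κ ι ℝ := Matrix.of fun k => g (Pi.single k 1) with hGdef
  have hG : Matrix.of (v x₀) * G = 1 := by
    ext i j
    have h1 := congrFun (LinearMap.congr_fun hg (Pi.single i 1)) j
    simp only [LinearMap.comp_apply, Matrix.vecMulLinear_apply, Matrix.single_one_vecMul,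
      LinearMap.id_apply] at h1
    rw [LinearMap.pi_apply_eq_sum_univ g, Finset.sum_apply] at h1
    rw [Matrix.one_apply, Matrix.mul_apply]
    simp only [Pi.single_apply, eq_comm (a := j)] at h1
    rw [← h1]
    refine Finset.sum_congr rfl fun k _ => ?_
    simp only [hGdef, Matrix.of_apply, Pi.smul_apply, smul_eq_mul, Matrix.row]
    refine congrArg _ (congrFun (congrArg g ?_) j)
    funext l
    simp [Pi.single_apply, eq_comm]
  -- `G` is a fixed right inverse at `x₀`, so this determinant equals 1 there; wherever it is
  -- nonzero the rows `v x` are independent.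
  have han : AnalyticOnNhd ℝ (fun x => (Matrix.of (v x) * G).det) Set.univ := by
    simp only [Matrix.det_apply', Matrix.mul_apply, Matrix.of_apply]
    intro x hx
    refine Finset.analyticAt_fun_sum _ fun σ _ => ?_
    refine analyticAt_const.mul (Finset.analyticAt_fun_prod _ fun i _ => ?_)
    exact Finset.analyticAt_fun_sum _ fun k _ => (hv _ k x hx).mul analyticAt_const
  filter_upwards [ae_ne_zero_of_analyticOnNhd μ han (x₀ := x₀) (by simp [hG])] with x hx
  refine Matrix.vecMul_injective_iff.1 fun a b hab => ?_
  have hinj := Matrix.vecMul_injective_of_isUnit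
    ((Matrix.isUnit_iff_isUnit_det _).2 (isUnit_iff_ne_zero.2 hx))
  refine hinj ?_
  have : a ᵥ* Matrix.of (v x) = b ᵥ* Matrix.of (v x) := hab
  simp only [← Matrix.vecMul_vecMul, this]

/-! ### Kruskal's permutation lemma -/

theorem sum_card_filter_of_unique {α ι : Type*} [Fintype ι] (F : Finset α) {p : α → ι → Prop}
    [∀ X, DecidablePred (p X)] [DecidablePred fun r => ∃ X ∈ F, p X r]
    (hp : ∀ r, ∀ X ∈ F, ∀ Y ∈ F, p X r → p Y r → X = Y) :
    ∑ X ∈ F, (Finset.univ.filter (p X)).card =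
      (Finset.univ.filter fun r => ∃ X ∈ F, p X r).card := by
  classical
  rw [← Finset.card_biUnion]
  · congr 1
    ext r
    simp
  · intro X hX Y hY hXY
    rw [Function.onFun, Finset.disjoint_left]
    intro r h1 h2
    exact hXY (hp r X hX Y hY (by simpa using h1) (by simpa using h2))

set_option maxHeartbeats 400000 in
open Submodule in
/-- If every hyperplane spanned by vectors of the family `c'` contains at least as many vectors of
`c` as of `c'`, then so does every subspace spanned by vectors of `c'`. -/
theorem card_mem_span_le {K V ι : Type*} [Field K] [AddCommGroup V] [Module K V]
    [FiniteDimensional K V] [Fintype ι] (c c' : ι → V)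
    (hc : ∀ r, c r ∈ span K (Set.range c'))
    (hyp : ∀ φ : Module.Dual K V, (∃ r, φ (c' r) ≠ 0) →
      Module.finrank K (span K (Set.range c')) ≤ {r | φ (c' r) = 0}.ncard + 1 →
      {r | φ (c' r) = 0}.ncard ≤ {r | φ (c r) = 0}.ncard)
    (T : Set ι) :
    {r | c' r ∈ span K (c' '' T)}.ncard ≤ {r | c r ∈ span K (c' '' T)}.ncard := by
  classical
  -- Induction on the codimension of the flat inside the span of `c'`; hyperplanes are the base
  -- where `hyp` applies.
  generalize hn : Module.finrank K (span K (Set.range c')) -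
    Module.finrank K (span K (c' '' T)) = n
  induction n using Nat.strong_induction_on generalizing T with
  | _ n ih =>
  set W := span K (Set.range c') with hW
  have hTW : ∀ T : Set ι, span K (c' '' T) ≤ W := fun T => span_mono (Set.image_subset_range _ _)
  have hcW : ∀ r, c' r ∈ W := fun r => subset_span ⟨r, rfl⟩
  set U := span K (c' '' T) with hU
  by_cases hall : ∀ r, c' r ∈ U
  · have hWU : W ≤ U := span_le.2 (by rintro _ ⟨r, rfl⟩; exact hall r)
    have : {r | c r ∈ U} = Set.univ := Set.eq_univ_of_forall fun r => hWU (hc r)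
    rw [this]
    exact Set.ncard_le_ncard (Set.subset_univ _)
  push Not at hall
  obtain ⟨r₀, hr₀⟩ := hall
  -- the flats covering `U`
  have hinsert : ∀ r, span K (c' '' insert r T) = span K {c' r} ⊔ U := by
    intro r; rw [Set.image_insert_eq, span_insert]
  have hlt : ∀ r, c' r ∉ U → U < span K {c' r} ⊔ U := by
    intro r hr
    refine lt_of_le_of_ne le_sup_right fun h => hr ?_
    rw [h]
    exact mem_sup_left (mem_span_singleton_self _)
  by_cases hone : ∀ r, c' r ∉ U → c' r ∈ span K {c' r₀} ⊔ U
  · -- `U` is a hyperplane of `W`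
    have hWeq : W = span K {c' r₀} ⊔ U := by
      refine le_antisymm (span_le.2 ?_) (sup_le ?_ (hTW T))
      · rintro _ ⟨r, rfl⟩
        by_cases h : c' r ∈ U
        · exact mem_sup_right h
        · exact hone r h
      · simpa using hcW r₀
    obtain ⟨φ, hφ0, hφU⟩ := exists_le_ker_of_notMem hr₀
    have hker : ∀ v ∈ W, φ v = 0 ↔ v ∈ U := by
      intro v hv
      refine ⟨fun h => ?_, fun h => hφU h⟩
      rw [hWeq, mem_sup] at hv
      obtain ⟨y, hy, z, hz, rfl⟩ := hv
      obtain ⟨a, rfl⟩ := mem_span_singleton.1 hy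
      have hz0 : φ z = 0 := hφU hz
      have : a = 0 := by simpa [hz0, hφ0] using h
      simpa [this] using hz
    have e1 : {r | c' r ∈ U} = {r | φ (c' r) = 0} := by
      ext r; exact (hker _ (hcW r)).symm
    have e2 : {r | c r ∈ U} = {r | φ (c r) = 0} := by
      ext r; exact (hker _ (hc r)).symm
    rw [e1, e2]
    refine hyp φ ⟨r₀, hφ0⟩ ?_
    rw [← e1]
    have h1 : Module.finrank K W ≤ Module.finrank K U + 1 := by
      rw [hWeq]
      refine (finrank_add_le_finrank_add_finrank _ _).trans ?_
      have := finrank_span_singleton (K := K) (v := c' r₀) (by rintro h; simp [h] at hr₀)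
      omega
    have h2 : Module.finrank K U ≤ {r | c' r ∈ U}.ncard := by
      have hs : U = span K (Set.range fun r : {r | c' r ∈ U} => c' r) := by
        refine le_antisymm (span_le.2 ?_) (span_le.2 ?_)
        · rintro _ ⟨r, hr, rfl⟩
          exact subset_span ⟨⟨r, subset_span ⟨r, hr, rfl⟩⟩, rfl⟩
        · rintro _ ⟨r, rfl⟩
          exact r.2
      have := finrank_range_le_card (R := K) (fun r : {r | c' r ∈ U} => c' r)
      rw [Set.finrank, ← hs] at this
      rwa [← Nat.card_coe_set_eq, Nat.card_eq_fintype_card]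
    omega
  · push Not at hone
    obtain ⟨r₁, hr₁, hr₁'⟩ := hone
    set F : Finset (Submodule K V) :=
      (Finset.univ.filter fun r => c' r ∉ U).image fun r => span K {c' r} ⊔ U with hF
    have hF2 : 2 ≤ F.card := by
      have hne : span K {c' r₀} ⊔ U ≠ span K {c' r₁} ⊔ U := by
        intro h
        apply hr₁'
        rw [h]
        exact mem_sup_left (mem_span_singleton_self _)
      rw [← Finset.card_pair hne]
      refine Finset.card_le_card ?_
      intro X hX
      simp only [Finset.mem_insert, Finset.mem_singleton] at hX
      rw [hF, Finset.mem_image]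
      rcases hX with rfl | rfl
      · exact ⟨r₀, by simpa using hr₀, rfl⟩
      · exact ⟨r₁, by simpa using hr₁, rfl⟩
    have hstep : ∀ X ∈ F, {r | c' r ∈ X}.ncard ≤ {r | c r ∈ X}.ncard := by
      intro X hX
      rw [hF, Finset.mem_image] at hX
      obtain ⟨r, hr, rfl⟩ := hX
      have hr : c' r ∉ U := by simpa using hr
      rw [← hinsert]
      refine ih _ ?_ _ rfl
      have h1 := finrank_lt_finrank_of_lt (hlt r hr)
      have h2 := finrank_mono (hTW (insert r T))
      rw [hinsert] at h2 ⊢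
      omega
    have hUX : ∀ X ∈ F, U ≤ X := by
      intro X hX
      rw [hF, Finset.mem_image] at hX
      obtain ⟨r, hr, rfl⟩ := hX
      exact le_sup_right
    -- A flat of `F` is recovered as `span {v} ⊔ U` from any of its vectors `v` outside `U`, so
    -- distinct flats meet only in `U`.
    have hdisj : ∀ v ∈ W, v ∉ U → ∀ X ∈ F, ∀ Y ∈ F, v ∈ X → v ∈ Y → X = Y := by
      intro v _ hvU
      have key : ∀ X ∈ F, v ∈ X → X = span K {v} ⊔ U := by
        intro X hX hvX
        rw [hF, Finset.mem_image] at hX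
        obtain ⟨r, hr, rfl⟩ := hX
        refine le_antisymm (sup_le ?_ le_sup_right) (sup_le ?_ le_sup_right)
        · obtain ⟨y, hy, z, hz, hv⟩ := mem_sup.1 hvX
          obtain ⟨a, rfl⟩ := mem_span_singleton.1 hy
          have ha : a ≠ 0 := by
            rintro rfl
            exact hvU (by simpa [← hv] using hz)
          rw [span_singleton_le_iff_mem]
          have : c' r = a⁻¹ • v - a⁻¹ • z := by
            rw [← hv, smul_add, smul_smul, inv_mul_cancel₀ ha]; simp
          rw [this]
          exact sub_mem (smul_mem _ _ (mem_sup_left (mem_span_singleton_self _)))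
            (smul_mem _ _ (mem_sup_right hz))
        · simpa using hvX
      intro X hX Y hY h1 h2
      rw [key X hX h1, key Y hY h2]
    -- count the vectors outside `U` flat by flat
    have hcount : ∀ d : ι → V, (∀ r, d r ∈ W) →
        ∑ X ∈ F, (Finset.univ.filter fun r => d r ∈ X ∧ d r ∉ U).card =
          ((Finset.univ.filter fun r => d r ∉ U ∧ ∃ X ∈ F, d r ∈ X)).card := by
      intro d hd
      rw [sum_card_filter_of_unique F fun r X hX Y hY h1 h2 =>
        hdisj _ (hd r) h1.2 X hX Y hY h1.1 h2.1]
      congr 1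
      refine Finset.filter_congr fun r _ => ?_
      exact ⟨fun ⟨X, hX, h, h'⟩ => ⟨h', X, hX, h⟩, fun ⟨h', X, hX, h⟩ => ⟨X, hX, h, h'⟩⟩
    have hsplit : ∀ d : ι → V, ∀ X ∈ F, {r | d r ∈ X}.ncard =
        (Finset.univ.filter fun r => d r ∈ X ∧ d r ∉ U).card + {r | d r ∈ U}.ncard := by
      intro d X hX
      have e1 : {r | d r ∈ X} = ((Finset.univ.filter fun r => d r ∈ X : Finset ι) : Set ι) := by
        ext; simp
      have e2 : {r | d r ∈ U} = ((Finset.univ.filter fun r => d r ∈ U : Finset ι) : Set ι) := by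
        ext; simp
      rw [e1, e2, Set.ncard_coe_finset, Set.ncard_coe_finset,
        ← Finset.card_filter_add_card_filter_not (s := Finset.univ.filter fun r => d r ∈ X)
          (fun r => d r ∉ U), Finset.filter_filter, Finset.filter_filter]
      congr 2
      ext r
      simp only [Finset.mem_filter, Finset.mem_univ, true_and, not_not]
      exact ⟨fun h => h.2, fun h => ⟨hUX X hX h, h⟩⟩
    have htot : ∀ d : ι → V, (Finset.univ.filter fun r => d r ∉ U).card + {r | d r ∈ U}.ncard =
        Fintype.card ι := by
      intro d
      have e2 : {r | d r ∈ U} = ((Finset.univ.filter fun r => d r ∈ U : Finset ι) : Set ι) := by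
        ext; simp
      rw [e2, Set.ncard_coe_finset, add_comm, Finset.card_filter_add_card_filter_not]
      rfl
    have hsum := Finset.sum_le_sum hstep
    rw [Finset.sum_congr rfl (hsplit c'), Finset.sum_congr rfl (hsplit c),
      Finset.sum_add_distrib, Finset.sum_add_distrib, hcount c' hcW, hcount c hc,
      Finset.sum_const, Finset.sum_const, smul_eq_mul, smul_eq_mul] at hsum
    have hc'full : (Finset.univ.filter fun r => c' r ∉ U ∧ ∃ X ∈ F, c' r ∈ X) =
        Finset.univ.filter fun r => c' r ∉ U := by
      ext r
      simp only [Finset.mem_filter, Finset.mem_univ, true_and, and_iff_left_iff_imp]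
      intro hr
      exact ⟨_, Finset.mem_image_of_mem _ (by simpa using hr),
        mem_sup_left (mem_span_singleton_self _)⟩
    have hcle : (Finset.univ.filter fun r => c r ∉ U ∧ ∃ X ∈ F, c r ∈ X).card ≤
        (Finset.univ.filter fun r => c r ∉ U).card :=
      Finset.card_le_card fun r => by simp +contextual
    rw [hc'full] at hsum
    have t1 := htot c
    have t2 := htot c'
    by_contra hcon
    push Not at hcon
    -- Summed over the flats, vectors in `U` are counted `F.card` times and the others at most once
    -- (exactly once for `c'`). Against the common total this leaves `(F.card - 1)` times the
    -- desired inequality, and `F.card - 1 = m + 1` is positive.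
    obtain ⟨m, hm⟩ := Nat.exists_eq_add_of_le hF2
    rw [hm] at hsum
    have : m * {r | c r ∈ U}.ncard ≤ m * {r | c' r ∈ U}.ncard := Nat.mul_le_mul_left _ hcon.le
    nlinarith

open Submodule in
/-- **Kruskal's permutation lemma.** -/
theorem exists_perm_smul_eq {K V ι : Type*} [Field K] [AddCommGroup V] [Module K V]
    [FiniteDimensional K V] [Fintype ι] (c c' : ι → V)
    (hc0 : ∀ r, c r ≠ 0) (hc2 : ∀ r s, c r ∈ span K {c s} → r = s)
    (hc : ∀ r, c r ∈ span K (Set.range c'))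
    (hyp : ∀ φ : Module.Dual K V, (∃ r, φ (c' r) ≠ 0) →
      Module.finrank K (span K (Set.range c')) ≤ {r | φ (c' r) = 0}.ncard + 1 →
      {r | φ (c' r) = 0}.ncard ≤ {r | φ (c r) = 0}.ncard) :
    ∃ (π : Equiv.Perm ι) (a : ι → K), (∀ r, a r ≠ 0) ∧ ∀ r, c' r = a r • c (π r) := by
  classical
  -- Only two kinds of flat are used: `T = ∅` shows that no `c' r` vanishes, and `T = {r}` that the
  -- line of `c' r` contains some `c s`.
  have key := card_mem_span_le c c' hc hyp
  have h0 : ∀ r, c' r ≠ 0 := by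
    intro r hr
    have h := key ∅
    have h1 : {r | c r ∈ span K (c' '' ∅)} = ∅ := by
      ext r; simp [hc0]
    rw [h1, Set.ncard_empty, Nat.le_zero, Set.ncard_eq_zero] at h
    have : r ∈ {r | c' r ∈ span K (c' '' ∅)} := by simp [hr]
    rw [h] at this
    exact this
  have hscale : ∀ {u v w : V}, u ≠ 0 → v ∈ span K {w} → u ∈ span K {w} → v ∈ span K {u} := by
    intro u v w hu hv hw
    obtain ⟨b, rfl⟩ := mem_span_singleton.1 hw
    obtain ⟨a, rfl⟩ := mem_span_singleton.1 hv
    have hb : b ≠ 0 := by rintro rfl; simp at hu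
    exact mem_span_singleton.2 ⟨a * b⁻¹, by rw [smul_smul, mul_assoc, inv_mul_cancel₀ hb, mul_one]⟩
  have hle : ∀ r, {s | c s ∈ span K {c' r}}.ncard ≤ 1 := by
    intro r
    rw [Set.ncard_le_one_iff]
    intro s t hs ht
    exact hc2 s t (hscale (hc0 t) hs ht)
  have hkey : ∀ r, {s | c' s ∈ span K {c' r}}.ncard ≤ {s | c s ∈ span K {c' r}}.ncard := by
    intro r
    simpa using key {r}
  have hex : ∀ r, ∃ s, c s ∈ span K {c' r} := by
    intro r
    have : 0 < {s | c' s ∈ span K {c' r}}.ncard :=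
      (Set.ncard_pos).2 ⟨r, mem_span_singleton_self _⟩
    exact (Set.ncard_pos).1 (this.trans_le (hkey r))
  choose f hf using hex
  have hinj : Function.Injective f := by
    intro r s hrs
    have h1 := (hkey r).trans (hle r)
    rw [Set.ncard_le_one_iff] at h1
    refine h1 (mem_span_singleton_self _) ?_
    have hr := hf r
    have hs := hf s
    rw [← hrs] at hs
    have h2 : c' s ∈ span K {c (f r)} := hscale (hc0 _) (mem_span_singleton_self _) hs
    exact (span_singleton_le_iff_mem _ _).2 hr h2
  have hmem : ∀ r, ∃ a : K, a • c (f r) = c' r := fun r =>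
    mem_span_singleton.1 (hscale (hc0 _) (mem_span_singleton_self _) (hf r))
  choose a ha using hmem
  refine ⟨Equiv.ofBijective f (Finite.injective_iff_bijective.1 hinj), a, ?_, fun r => (ha r).symm⟩
  intro r hr
  have := ha r
  rw [hr, zero_smul] at this
  exact h0 r this.symm

/-! ### Rank inequalities and Kruskal ranks -/

/-- **Sylvester's rank inequality.** -/
theorem Matrix.rank_add_rank_le_rank_mul_add_card {K m n o : Type*} [Field K] [Fintype n]
    [Fintype o] (A : Matrix m n K) (B : Matrix n o K) :
    A.rank + B.rank ≤ (A * B).rank + Fintype.card n := by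
  have hAB : (A * B).rank =
      Module.finrank K
        (LinearMap.range (A.mulVecLin.domRestrict (LinearMap.range B.mulVecLin))) := by
    rw [Matrix.rank, Matrix.mulVecLin_mul, LinearMap.range_comp, LinearMap.range_domRestrict]
  have h1 := LinearMap.finrank_range_add_finrank_ker
    (A.mulVecLin.domRestrict (LinearMap.range B.mulVecLin))
  have h2 := LinearMap.finrank_range_add_finrank_ker A.mulVecLin
  rw [Module.finrank_fintype_fun_eq_card] at h2
  have h3 : Module.finrank K
      (LinearMap.ker (A.mulVecLin.domRestrict (LinearMap.range B.mulVecLin))) ≤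
      Module.finrank K (LinearMap.ker A.mulVecLin) := by
    rw [LinearMap.ker_domRestrict, ← Submodule.finrank_map_subtype_eq]
    exact Submodule.finrank_mono (by
      rintro _ ⟨x, hx, rfl⟩
      exact hx)
  have e1 : A.rank = Module.finrank K (LinearMap.range A.mulVecLin) := rfl
  have e2 : B.rank = Module.finrank K (LinearMap.range B.mulVecLin) := rfl
  omega

theorem Submodule.finrank_finset_sup_le {K V ι : Type*} [Field K] [AddCommGroup V] [Module K V]
    [FiniteDimensional K V] (s : Finset ι) (P : ι → Submodule K V) :
    Module.finrank K ↥(s.sup P) ≤ ∑ r ∈ s, Module.finrank K (P r) := by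
  classical
  induction s using Finset.induction_on with
  | empty => simp
  | insert a s ha ih =>
    rw [Finset.sup_insert, Finset.sum_insert ha]
    exact (Submodule.finrank_add_le_finrank_add_finrank _ _).trans (by omega)

/-- The family `c` has Kruskal rank at least `k`. -/
def KruskalRankGE {V ι : Type*} [AddCommGroup V] [Module ℝ V] (k : ℕ) (c : ι → V) : Prop :=
  ∀ s : Finset ι, s.card ≤ k → LinearIndepOn ℝ c (s : Set ι)

/-- The block matrix `A` has block Kruskal rank at least `k`: the columns of any `k` blocks are
jointly linearly independent. -/
def BlockKruskalRankGE {m l ι : Type*} [Fintype l] (k : ℕ) (A : ι → Matrix m l ℝ) : Prop :=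
  ∀ s : Finset ι, s.card ≤ k →
    LinearIndepOn ℝ (fun p : ι × l => (A p.1).col p.2) ((s ×ˢ Finset.univ : Finset (ι × l)) : Set _)

open Matrix

/-- Contraction along the third mode: every later rank argument starts from this matrix identity. -/
theorem sum_dual_smul_eq {m n ι V : Type*} [AddCommGroup V] [Module ℝ V] [Fintype ι] {c c' : ι → V}
    {S S' : ι → Matrix m n ℝ} (h : ∀ i j, ∑ r, S r i j • c r = ∑ r, S' r i j • c' r)
    (φ : Module.Dual ℝ V) : ∑ r, φ (c r) • S r = ∑ r, φ (c' r) • S' r := by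
  ext i j
  have := congrArg φ (h i j)
  simpa [Matrix.sum_apply, mul_comm] using this

/-! ### Uniqueness of the block term decomposition -/

section

variable {m n l ι : Type*} [Fintype n] [Fintype l]

theorem BlockKruskalRankGE.eq_zero [Fintype ι] {k : ℕ} {A : ι → Matrix m l ℝ}
    (hA : BlockKruskalRankGE k A)
    (s : Finset ι) (hs : s.card ≤ k) (u : ι → l → ℝ) (hu : ∀ r, r ∉ s → u r = 0)
    (h : ∑ r, A r *ᵥ u r = 0) : u = 0 := by
  have h1 := linearIndepOn_finset_iff.1 (hA s hs) (fun p => u p.1 p.2) ?_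
  · funext r j
    by_cases hr : r ∈ s
    · exact h1 (r, j) (by simpa using hr)
    · rw [hu r hr]; rfl
  · rw [Finset.sum_product]
    rw [← Finset.sum_subset (Finset.subset_univ s) fun r _ hr => by
      rw [hu r hr, mulVec_zero]] at h
    rw [← h]
    refine Finset.sum_congr rfl fun r _ => ?_
    ext i
    simp [mulVec, dotProduct, Finset.sum_apply, mul_comm]

theorem BlockKruskalRankGE.le_rank [Fintype m] {k : ℕ} {A : ι → Matrix m l ℝ}
    (hA : BlockKruskalRankGE k A)
    (W : Finset ι) (d : ι → ℝ) (hd : ∀ r ∈ W, d r ≠ 0) :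
    min W.card k * Fintype.card l ≤
      (Matrix.of fun (i : m) (p : W × l) => d p.1 * A p.1 i p.2).rank := by
  classical
  obtain ⟨s, hsW, hs⟩ := Finset.exists_subset_card_eq (min_le_left W.card k)
  have hli := hA s (hs.trans_le (min_le_right _ _))
  have hli' := hli.linearIndependent.units_smul
    (fun p => Units.mk0 (d p.1.1) (hd _ (hsW (Finset.mem_product.1 p.2).1)))
  have hcard := finrank_span_eq_card hli'
  simp only [Finset.coe_sort_coe, Fintype.card_coe, Finset.card_product, hs,
    Finset.card_univ] at hcard
  rw [← hcard, Matrix.rank_eq_finrank_span_cols]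
  refine Submodule.finrank_mono (Submodule.span_mono ?_)
  rintro _ ⟨p, rfl⟩
  refine ⟨(⟨p.1.1, hsW (Finset.mem_product.1 p.2).1⟩, p.1.2), ?_⟩
  ext i
  simp [Units.smul_def]

/-- The sum factors as the concatenated blocks `d r • A r` times the transpose of the concatenated
`B r`, over `r ∈ W`, with inner dimension `W.card * Fintype.card l`; Sylvester's inequality applies.
When `W.card` is at most `kA` and `kB`, the rank is forced to be full. -/
theorem le_rank_sum_smul_mul_transpose [Fintype m] [Fintype ι] {kA kB : ℕ}
    {A : ι → Matrix m l ℝ} {B : ι → Matrix n l ℝ}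
    (hA : BlockKruskalRankGE kA A) (hB : BlockKruskalRankGE kB B) (d : ι → ℝ) (W : Finset ι)
    (hW : ∀ r, r ∈ W ↔ d r ≠ 0) :
    (min W.card kA + min W.card kB) * Fintype.card l ≤
      (∑ r, d r • (A r * (B r)ᵀ)).rank + W.card * Fintype.card l := by
  classical
  have h1 := hA.le_rank W d fun r hr => (hW r).1 hr
  have h2 := hB.le_rank W (fun _ => 1) fun r hr => one_ne_zero
  have h3 := Matrix.rank_add_rank_le_rank_mul_add_card
    (Matrix.of fun (i : m) (p : W × l) => d p.1 * A p.1 i p.2)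
    (Matrix.of fun (i : n) (p : W × l) => (1 : ℝ) * B p.1 i p.2)ᵀ
  rw [Matrix.rank_transpose, Fintype.card_prod, Fintype.card_coe] at h3
  have h4 : (Matrix.of fun (i : m) (p : W × l) => d p.1 * A p.1 i p.2) *
    (Matrix.of fun (i : n) (p : W × l) => (1 : ℝ) * B p.1 i p.2)ᵀ =
      ∑ r, d r • (A r * (B r)ᵀ) := by
    rw [← Finset.sum_subset (Finset.subset_univ W)
      (fun r _ hr => by rw [not_not.1 (mt (hW r).2 hr), zero_smul])]
    ext i j
    rw [Matrix.mul_apply, Fintype.sum_prod_type, Matrix.sum_apply, ← Finset.sum_coe_sort W]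
    refine Finset.sum_congr rfl fun r _ => ?_
    simp [Matrix.mul_apply, Finset.mul_sum, mul_assoc]
  rw [h4] at h3
  rw [add_mul]
  omega

theorem range_sum_smul_le [Fintype ι] (S : ι → Matrix m n ℝ) (d : ι → ℝ) (W : Finset ι)
    (hW : ∀ r, r ∈ W ↔ d r ≠ 0) :
    LinearMap.range (∑ r, d r • S r).mulVecLin ≤
      W.sup fun r => LinearMap.range (S r).mulVecLin := by
  rintro _ ⟨x, rfl⟩
  rw [Matrix.mulVecLin_apply, Matrix.sum_mulVec]
  refine Submodule.sum_mem _ fun r _ => ?_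
  rw [Matrix.smul_mulVec]
  by_cases hr : r ∈ W
  · exact Submodule.smul_mem _ _
      ((Finset.le_sup (f := fun r => LinearMap.range (S r).mulVecLin) hr) ⟨x, rfl⟩)
  · rw [not_not.1 (mt (hW r).2 hr), zero_smul]
    exact Submodule.zero_mem _

theorem finrank_sup_range_le [Finite m] {L : ℕ} {S : ι → Matrix m n ℝ} (hS : ∀ r, (S r).rank ≤ L)
    (W : Finset ι) :
    Module.finrank ℝ ↥(W.sup fun r => LinearMap.range (S r).mulVecLin) ≤ W.card * L := by
  refine (Submodule.finrank_finset_sup_le _ _).trans ?_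
  rw [← smul_eq_mul]
  exact Finset.sum_le_card_nsmul _ _ _ fun r _ => hS r

variable [Fintype ι]

theorem rank_sum_smul_le [Finite m] {L : ℕ} {S : ι → Matrix m n ℝ} (hS : ∀ r, (S r).rank ≤ L)
    (d : ι → ℝ) (W : Finset ι) (hW : ∀ r, r ∈ W ↔ d r ≠ 0) : (∑ r, d r • S r).rank ≤ W.card * L :=
  (Submodule.finrank_mono (range_sum_smul_le S d W hW)).trans (finrank_sup_range_le hS W)

/-- The range of the sum lies in the sum of the ranges, whose dimension is at most `W.card * L`;
full rank makes the two spaces equal. -/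
theorem range_le_range_sum_smul [Finite m] {L : ℕ} {S : ι → Matrix m n ℝ} (hS : ∀ r, (S r).rank ≤ L)
    (d : ι → ℝ) (W : Finset ι) (hW : ∀ r, r ∈ W ↔ d r ≠ 0)
    (h : W.card * L ≤ (∑ r, d r • S r).rank) {r : ι} (hr : r ∈ W) :
    LinearMap.range (S r).mulVecLin ≤ LinearMap.range (∑ r, d r • S r).mulVecLin := by
  rw [Submodule.eq_of_le_of_finrank_le (range_sum_smul_le S d W hW)
    ((finrank_sup_range_le hS W).trans h)]
  exact Finset.le_sup (f := fun r => LinearMap.range (S r).mulVecLin) hr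

/-- Adjoining `r` to the complement of `W` gives at most `k` indices, hence independent vectors, so
a functional separates `c r` from the rest. -/
theorem KruskalRankGE.exists_dual {V : Type*} [AddCommGroup V] [Module ℝ V] {k : ℕ} {c : ι → V}
    (hc : KruskalRankGE k c) (W : Finset ι) (hW : Fintype.card ι + 1 ≤ W.card + k) {r : ι}
    (hr : r ∈ W) : ∃ φ : Module.Dual ℝ V, φ (c r) ≠ 0 ∧ ∀ s, s ∉ W → φ (c s) = 0 := by
  classical
  have h1 := hc (insert r Wᶜ) (by
    rw [Finset.card_insert_of_notMem (by simpa using hr), Finset.card_compl]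
    have := W.card_le_univ
    omega)
  rw [Finset.coe_insert] at h1
  have h2 := h1.notMem_span_of_insert (by simpa using hr)
  obtain ⟨φ, hφ, hker⟩ := Submodule.exists_le_ker_of_notMem h2
  exact ⟨φ, hφ, fun s hs => hker (Submodule.subset_span ⟨s, by simpa using hs, rfl⟩)⟩

/-- In a block term decomposition whose third factor is known, the rank-`L` blocks are unique. -/
theorem block_eq_of_sum_smul_eq [Fintype m] {V : Type*} [AddCommGroup V] [Module ℝ V] {kA kB kC : ℕ}
    {A : ι → Matrix m l ℝ} {B : ι → Matrix n l ℝ} {c : ι → V} {S' : ι → Matrix m n ℝ}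
    (hA : BlockKruskalRankGE kA A) (hB : BlockKruskalRankGE kB B) (hc : KruskalRankGE kC c)
    (hkA : kA ≤ Fintype.card ι) (hkB : kB ≤ Fintype.card ι) (hkC : kC ≤ Fintype.card ι)
    (hk : 2 * Fintype.card ι + 2 ≤ kA + kB + kC)
    (hS' : ∀ r, (S' r).rank ≤ Fintype.card l)
    (h : ∀ i j, ∑ r, (A r * (B r)ᵀ) i j • c r = ∑ r, S' r i j • c r) (r : ι) :
    S' r = A r * (B r)ᵀ := by
  classical
  -- The columns of `S' r` lie in the span of the `A s` with `s ∈ W`: as `W.card = card ι + 1 - kC`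
  -- is at most `kA` and `kB`, the contracted sum has full rank.
  have hrep : ∀ (r : ι) (W : Finset ι), r ∈ W → W.card + kC = Fintype.card ι + 1 →
      ∀ x : n → ℝ, ∃ u : ι → l → ℝ, (∀ s, s ∉ W → u s = 0) ∧ S' r *ᵥ x = ∑ s, A s *ᵥ u s := by
    intro r W hr hW x
    obtain ⟨φ, hφr, hφ⟩ := hc.exists_dual W hW.ge hr
    have hT := sum_dual_smul_eq h φ
    set W' : Finset ι := Finset.univ.filter fun s => φ (c s) ≠ 0 with hW'
    have hmem : ∀ s, s ∈ W' ↔ φ (c s) ≠ 0 := by simp [hW']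
    have hsub : W' ⊆ W := fun s hs => by
      by_contra hsW
      exact (hmem s).1 hs (hφ s hsW)
    have hcard := Finset.card_le_card hsub
    have hlow := le_rank_sum_smul_mul_transpose hA hB (fun s => φ (c s)) W' hmem
    rw [min_eq_left (by omega), min_eq_left (by omega), add_mul, hT] at hlow
    have hle := range_le_range_sum_smul hS' (fun s => φ (c s)) W' hmem (by omega) ((hmem r).2 hφr)
    obtain ⟨y, hy⟩ := hle ⟨x, rfl⟩
    refine ⟨fun s => φ (c s) • ((B s)ᵀ *ᵥ y), fun s hs => by simp [hφ s hs], ?_⟩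
    rw [← hT] at hy
    rw [Matrix.mulVecLin_apply, Matrix.mulVecLin_apply] at hy
    rw [← hy, Matrix.sum_mulVec]
    refine Finset.sum_congr rfl fun s _ => ?_
    rw [Matrix.smul_mulVec, Matrix.mulVec_smul, Matrix.mulVec_mulVec]
  have hW₀ : ∀ r, ∃ W : Finset ι, r ∈ W ∧ W.card + kC = Fintype.card ι + 1 := by
    intro r
    obtain ⟨W, hW1, hW2⟩ := Finset.exists_superset_card_eq (s := {r})
      (n := Fintype.card ι + 1 - kC) (by simp; omega) (by omega)
    exact ⟨W, by simpa using hW1, by omega⟩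
  have hcol : ∀ (r : ι) (x : n → ℝ), ∃ z : l → ℝ, S' r *ᵥ x = A r *ᵥ z := by
    intro r x
    obtain ⟨W, hr, hW⟩ := hW₀ r
    obtain ⟨u, hu, hux⟩ := hrep r W hr hW x
    refine ⟨u r, ?_⟩
    rw [hux]
    refine Finset.sum_eq_single r (fun j _ hj => ?_) (by simp)
    suffices u j = 0 by rw [this, mulVec_zero]
    by_cases hjW : j ∈ W
    swap
    · exact hu j hjW
    -- Exchange `j` for some `j'` outside `W`, which exists because `kC ≥ 2`. Both representations
    -- live on `insert j' W`, of size `card ι + 2 - kC ≤ kA`, so they coincide and the `j`-component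
    -- vanishes.
    obtain ⟨j', hj'⟩ : ∃ j', j' ∉ W := by
      by_contra! hcon
      have := (Finset.card_eq_iff_eq_univ W).2 (Finset.eq_univ_of_forall hcon)
      omega
    have hj'e : j' ∉ W.erase j := fun h => hj' (Finset.mem_of_mem_erase h)
    have hW1 := Finset.card_erase_add_one hjW
    obtain ⟨u', hu', hux'⟩ := hrep r (insert j' (W.erase j))
      (Finset.mem_insert_of_mem (Finset.mem_erase.2 ⟨hj.symm, hr⟩))
      (by rw [Finset.card_insert_of_notMem hj'e]; omega) x
    have hz := hA.eq_zero (insert j' W) (by rw [Finset.card_insert_of_notMem hj']; omega)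
      (u - u') (fun s hs => by
        rw [Finset.mem_insert, not_or] at hs
        rw [Pi.sub_apply, hu s hs.2, hu' s (by simp [hs.1, hs.2]), sub_zero]) (by
        simp only [Pi.sub_apply, Matrix.mulVec_sub, Finset.sum_sub_distrib]
        rw [← hux, ← hux', sub_self])
    have hj2 := congrFun hz j
    rw [Pi.sub_apply, hu' j (by
      simp only [Finset.mem_insert, Finset.mem_erase, ne_eq, not_true_eq_false, false_and, or_false]
      rintro rfl
      exact hj' hjW), sub_zero] at hj2
    exact hj2
  choose z hz using hcol
  obtain ⟨W, hr, hW⟩ := hW₀ r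
  obtain ⟨φ, hφr, hφ⟩ := hc.exists_dual W hW.ge hr
  have hT := sum_dual_smul_eq h φ
  refine Matrix.mulVec_injective ?_
  funext x
  -- Now `S' s *ᵥ x = A s *ᵥ z s x`, so the contracted identity can be compared block by block.
  have hu := hA.eq_zero W (by omega) (fun s => φ (c s) • ((B s)ᵀ *ᵥ x - z s x))
    (fun s hs => by simp [hφ s hs]) (by
      have h1 := congrArg (fun M => M *ᵥ x) hT
      simp only [Matrix.sum_mulVec, Matrix.smul_mulVec, hz] at h1
      simp only [Matrix.mulVec_smul, Matrix.mulVec_sub, smul_sub, Finset.sum_sub_distrib,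
        Matrix.mulVec_mulVec]
      rw [h1, sub_self])
  have hur := congrFun hu r
  simp only [Pi.zero_apply, smul_eq_zero, hφr, false_or, sub_eq_zero] at hur
  show S' r *ᵥ x = (A r * (B r)ᵀ) *ᵥ x
  rw [hz, ← hur, Matrix.mulVec_mulVec]

/-- Uniqueness, up to permutation and scaling, of the decomposition in rank-`(L, L, 1)` terms
under a Kruskal-type condition. -/
theorem exists_perm_of_block_term_eq [Fintype m] {V : Type*} [AddCommGroup V] [Module ℝ V]
    [FiniteDimensional ℝ V] {kA kB kC : ℕ}
    {A : ι → Matrix m l ℝ} {B : ι → Matrix n l ℝ} {c c' : ι → V} {S' : ι → Matrix m n ℝ}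
    (hl : 0 < Fintype.card l)
    (hA : BlockKruskalRankGE kA A) (hB : BlockKruskalRankGE kB B) (hc : KruskalRankGE kC c)
    (hkA : kA ≤ Fintype.card ι) (hkB : kB ≤ Fintype.card ι) (hkC : kC ≤ Fintype.card ι)
    (hk : 2 * Fintype.card ι + 2 ≤ kA + kB + kC)
    (hS' : ∀ r, (S' r).rank ≤ Fintype.card l)
    (h : ∀ i j, ∑ r, (A r * (B r)ᵀ) i j • c r = ∑ r, S' r i j • c' r) :
    ∃ (π : Equiv.Perm ι) (a : ι → ℝ), (∀ r, a r ≠ 0) ∧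
      ∀ r, a r • S' r = A (π r) * (B (π r))ᵀ := by
  classical
  have hrank : ∀ φ : Module.Dual ℝ V,
      min (Finset.univ.filter fun r => φ (c r) ≠ 0).card kA +
      min (Finset.univ.filter fun r => φ (c r) ≠ 0).card kB ≤
      (Finset.univ.filter fun r => φ (c r) ≠ 0).card +
      (Finset.univ.filter fun r => φ (c' r) ≠ 0).card := by
    intro φ
    have h1 := le_rank_sum_smul_mul_transpose hA hB (fun s => φ (c s))
      (Finset.univ.filter fun r => φ (c r) ≠ 0) (by simp)
    rw [sum_dual_smul_eq h φ] at h1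
    have h2 := rank_sum_smul_le hS' (fun s => φ (c' s))
      (Finset.univ.filter fun r => φ (c' r) ≠ 0) (by simp)
    refine Nat.le_of_mul_le_mul_right (h1.trans ?_) hl
    rw [add_mul]
    omega
  have hle : ∀ d : ι → V, ∀ φ : Module.Dual ℝ V,
      (Finset.univ.filter fun r => φ (d r) ≠ 0).card + {r | φ (d r) = 0}.ncard =
        Fintype.card ι := by
    intro d φ
    have e : {r | φ (d r) = 0} =
        ((Finset.univ.filter fun r => φ (d r) = 0 : Finset ι) : Set ι) := by
      ext; simp
    rw [e, Set.ncard_coe_finset, add_comm, Finset.card_filter_add_card_filter_not]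
    rfl
  have hc2 : ∀ r s, c r ∈ Submodule.span ℝ {c s} → r = s := by
    intro r s hrs
    by_contra hne
    have h1 := hc {r, s} (by rw [Finset.card_pair hne]; omega)
    rw [Finset.coe_insert, Finset.coe_singleton] at h1
    have h2 := h1.notMem_span_of_insert (by simpa using hne)
    rw [Set.image_singleton] at h2
    exact h2 hrs
  have hc0 : ∀ r, c r ≠ 0 := by
    intro r
    have h1 := hc {r} (by rw [Finset.card_singleton]; omega)
    rw [Finset.coe_singleton, linearIndepOn_singleton_iff] at h1
    exact h1
  -- A functional killing every `c'` but not `c r` would make a sum of positive rank equal to zero.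
  have hspan : ∀ r, c r ∈ Submodule.span ℝ (Set.range c') := by
    intro r
    by_contra hr
    obtain ⟨φ, hφ, hker⟩ := Submodule.exists_le_ker_of_notMem hr
    have h1 := hrank φ
    have h2 : (Finset.univ.filter fun r => φ (c' r) ≠ 0) = ∅ := by
      rw [Finset.filter_eq_empty_iff]
      intro s _
      rw [not_not]
      exact hker (Submodule.subset_span ⟨s, rfl⟩)
    have h3 : 0 < (Finset.univ.filter fun r => φ (c r) ≠ 0).card :=
      Finset.card_pos.2 ⟨r, by simpa using hφ⟩
    have h4 := hle c φ
    rw [h2, Finset.card_empty] at h1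
    omega
  have hfin : kC ≤ Module.finrank ℝ (Submodule.span ℝ (Set.range c')) := by
    obtain ⟨s, -, hs⟩ := Finset.exists_subset_card_eq (s := (Finset.univ : Finset ι)) (n := kC)
      (by simpa using hkC)
    have h1 := finrank_span_eq_card (hc s hs.le).linearIndependent
    simp only [Finset.coe_sort_coe, Fintype.card_coe, hs] at h1
    rw [← h1]
    refine Submodule.finrank_mono (Submodule.span_le.2 ?_)
    rintro _ ⟨r, rfl⟩
    exact hspan r
  -- Let `w`, `w'` count the nonzero `φ (c r)`, `φ (c' r)`. By `hfin`, `w' ≤ card ι + 1 - kC`. If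
  -- `w` exceeded `kA` or `kB`, `hrank` would contradict `hk`; otherwise `hrank` reads `2 * w ≤ w +
  -- w'`.
  obtain ⟨π, a, ha, hπ⟩ := exists_perm_smul_eq c c' hc0 hc2 hspan (by
    intro φ _ hφ
    have h1 := hrank φ
    have h2 := hle c φ
    have h3 := hle c' φ
    omega)
  refine ⟨π, a, ha, fun r => ?_⟩
  -- Moving the scalars into the blocks and relabelling makes the third factor of both
  -- decompositions equal to `c`.
  have := block_eq_of_sum_smul_eq (S' := fun s => a (π.symm s) • S' (π.symm s)) hA hB hc hkA hkB hkC
    hk (fun s => ?_) (fun i j => ?_) (π r)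
  · simpa using this
  · refine le_trans ?_ (hS' (π.symm s))
    have e : a (π.symm s) • S' (π.symm s) =
        (a (π.symm s) • (1 : Matrix m m ℝ)) * S' (π.symm s) := by
      simp
    rw [e]
    exact Matrix.rank_mul_le_right _ _
  · rw [h i j, ← Equiv.sum_comp π fun t => (a (π.symm t) • S' (π.symm t)) i j • c t]
    refine Finset.sum_congr rfl fun s _ => ?_
    simp [hπ, smul_smul, mul_comm]

end

/-! ### Genericity of the Kruskal ranks -/

section

variable {E : Type*} [NormedAddCommGroup E] [NormedSpace ℝ E] [FiniteDimensional ℝ E]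
  [MeasurableSpace E] [BorelSpace E] (μ : Measure E) [μ.IsAddHaarMeasure]

/-- Surjectivity supplies the one good point: parameters at which the vectors indexed by `s` are
distinct standard basis vectors. -/
theorem ae_linearIndepOn {ι κ : Type*} [Fintype κ] {v : E → ι → κ → ℝ}
    (hv : ∀ i k, AnalyticOnNhd ℝ (fun x => v x i k) Set.univ) (hsurj : Function.Surjective v)
    (s : Finset ι) (hs : s.card ≤ Fintype.card κ) :
    ∀ᵐ x ∂μ, LinearIndepOn ℝ (v x) (s : Set ι) := by
  classical
  obtain ⟨e⟩ : Nonempty (s ↪ κ) := Function.Embedding.nonempty_of_card_le (by simpa using hs)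
  obtain ⟨x₀, hx₀⟩ := hsurj fun i => if h : i ∈ s then Pi.single (e ⟨i, h⟩) 1 else 0
  refine ae_linearIndependent_of_analyticOnNhd μ (v := fun x (i : (s : Set ι)) => v x i)
    (x₀ := x₀) (fun i k => hv i k) ?_
  have : LinearIndependent ℝ fun i : (s : Set ι) => Pi.basisFun ℝ κ (e i) :=
    (Pi.basisFun ℝ κ).linearIndependent.comp _ e.injective
  convert this using 2 with i
  rw [hx₀]
  have hi : (i : ι) ∈ s := i.2
  simp [hi]

theorem ae_kruskalRankGE {ι κ : Type*} [Finite ι] [Fintype κ] {v : E → ι → κ → ℝ}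
    (hv : ∀ i k, AnalyticOnNhd ℝ (fun x => v x i k) Set.univ) (hsurj : Function.Surjective v)
    {k : ℕ} (hk : k ≤ Fintype.card κ) : ∀ᵐ x ∂μ, KruskalRankGE k (v x) := by
  unfold KruskalRankGE
  simp only [ae_all_iff, Filter.eventually_imp_distrib_left]
  exact fun s hs => ae_linearIndepOn μ hv hsurj s (hs.trans hk)

theorem ae_blockKruskalRankGE {ι m l : Type*} [Finite ι] [Fintype m] [Fintype l]
    {A : E → ι → Matrix m l ℝ}
    (hv : ∀ r i j, AnalyticOnNhd ℝ (fun x => A x r i j) Set.univ) (hsurj : Function.Surjective A)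
    {k : ℕ} (hk : k * Fintype.card l ≤ Fintype.card m) :
    ∀ᵐ x ∂μ, BlockKruskalRankGE k (A x) := by
  unfold BlockKruskalRankGE
  simp only [ae_all_iff, Filter.eventually_imp_distrib_left]
  refine fun s hs => ae_linearIndepOn μ (v := fun x (p : ι × l) => (A x p.1).col p.2)
    (fun p i => hv p.1 i p.2) (fun w => ?_) _ ?_
  · obtain ⟨x, hx⟩ := hsurj fun r => Matrix.of fun i j => w (r, j) i
    exact ⟨x, by ext p i; simp [hx]⟩
  · rw [Finset.card_product, Finset.card_univ]
    exact (Nat.mul_le_mul_right _ hs).trans hk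

end

/-! ### Measure and analyticity on the factor space -/

theorem borelSpace_factorSpace (I J K L R : ℕ) : BorelSpace (FactorSpace I J K L R) :=
  haveI : BorelSpace ((Fin R → Fin J → Fin L → ℝ) × (Fin K → Fin R → ℝ)) := Prod.borelSpace
  Prod.borelSpace

attribute [instance] borelSpace_factorSpace

theorem isAddHaarMeasure_volume_factorSpace (I J K L R : ℕ) :
    (volume : Measure (FactorSpace I J K L R)).IsAddHaarMeasure :=
  haveI : ∀ a b : ℕ, (volume : Measure (Fin a → Fin b → ℝ)).IsAddHaarMeasure := fun _ _ =>
    Measure.pi.isAddHaarMeasure _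
  haveI : ∀ a b c : ℕ, (volume : Measure (Fin a → Fin b → Fin c → ℝ)).IsAddHaarMeasure :=
    fun _ _ _ => Measure.pi.isAddHaarMeasure _
  haveI : MeasurableAdd₂ ((Fin R → Fin J → Fin L → ℝ) × (Fin K → Fin R → ℝ)) :=
    ContinuousAdd.measurableMul₂
  haveI : (volume : Measure ((Fin R → Fin J → Fin L → ℝ) × (Fin K → Fin R → ℝ))).IsAddHaarMeasure :=
    Measure.prod.instIsAddHaarMeasure _ _
  Measure.prod.instIsAddHaarMeasure _ _

attribute [instance] isAddHaarMeasure_volume_factorSpace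

section

variable {I J K L R : ℕ} (x : FactorSpace I J K L R)

theorem analyticAt_factorSpace_fst (r : Fin R) (i : Fin I) (l : Fin L) :
    AnalyticAt ℝ (fun x : FactorSpace I J K L R => x.1 r i l) x :=
  let f : FactorSpace I J K L R →ₗ[ℝ] ℝ :=
    { toFun := fun x => x.1 r i l, map_add' := fun _ _ => rfl, map_smul' := fun _ _ => rfl }
  f.toContinuousLinearMap.analyticAt x

theorem analyticAt_factorSpace_snd_fst (r : Fin R) (j : Fin J) (l : Fin L) :
    AnalyticAt ℝ (fun x : FactorSpace I J K L R => x.2.1 r j l) x :=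
  let f : FactorSpace I J K L R →ₗ[ℝ] ℝ :=
    { toFun := fun x => x.2.1 r j l, map_add' := fun _ _ => rfl, map_smul' := fun _ _ => rfl }
  f.toContinuousLinearMap.analyticAt x

theorem analyticAt_factorSpace_snd_snd (k : Fin K) (r : Fin R) :
    AnalyticAt ℝ (fun x : FactorSpace I J K L R => x.2.2 k r) x :=
  let f : FactorSpace I J K L R →ₗ[ℝ] ℝ :=
    { toFun := fun x => x.2.2 k r, map_add' := fun _ _ => rfl, map_smul' := fun _ _ => rfl }
  f.toContinuousLinearMap.analyticAt x

end

/-! ### The coupled problem -/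

theorem Matrix.mulVec_surjective_of_rank_eq {m n : Type*} [Fintype m] [Fintype n]
    {P : Matrix m n ℝ} (hP : P.rank = Fintype.card m) : Function.Surjective P.mulVec := by
  have : LinearMap.range P.mulVecLin = ⊤ :=
    Submodule.eq_top_of_finrank_eq (by rw [Module.finrank_fintype_fun_eq_card]; exact hP)
  exact LinearMap.range_eq_top.1 this

theorem ll1Tensor_apply {I J K L R : ℕ} (A : Fin R → Matrix (Fin I) (Fin L) ℝ)
    (B : Fin R → Matrix (Fin J) (Fin L) ℝ) (C : Matrix (Fin K) (Fin R) ℝ) (i : Fin I) (j : Fin J)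
    (k : Fin K) : ll1Tensor A B C i j k = ∑ r, (A r * (B r)ᵀ) i j * C k r := by
  simp [ll1Tensor, outerProduct, Finset.sum_apply]

theorem ae_linearIndependent_degraded {IH JH IM JM KH L R : ℕ}
    {P₁ : Matrix (Fin IH) (Fin IM) ℝ} {P₂ : Matrix (Fin JH) (Fin JM) ℝ}
    (hP₁ : P₁.rank = IH) (hP₂ : P₂.rank = JH) (hL : 0 < L) (hR : R ≤ IH * JH) :
    ∀ᵐ x : FactorSpace IM JM KH L R, LinearIndependent ℝ
      (fun (r : Fin R) (p : Fin IH × Fin JH) =>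
        (P₁ * Matrix.of (x.1 r) * (P₂ * Matrix.of (x.2.1 r))ᵀ) p.1 p.2) := by
  obtain ⟨e⟩ : Nonempty (Fin R ↪ Fin IH × Fin JH) :=
    Function.Embedding.nonempty_of_card_le (by simpa using hR)
  choose u hu using fun i => Matrix.mulVec_surjective_of_rank_eq (by simpa using hP₁)
    (Pi.single i 1 : Fin IH → ℝ)
  choose w hw using fun j => Matrix.mulVec_surjective_of_rank_eq (by simpa using hP₂)
    (Pi.single j 1 : Fin JH → ℝ)
  -- At this point the blocks have only their first column nonzero, chosen through the surjectivity
  -- of `P₁` and `P₂` so that the `r`-th degraded block is the matrix unit at position `e r`.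
  refine ae_linearIndependent_of_analyticOnNhd (E := FactorSpace IM JM KH L R) volume
    (x₀ := (fun r => vecMulVec (u (e r).1) (Pi.single ⟨0, hL⟩ 1),
      fun r => vecMulVec (w (e r).2) (Pi.single ⟨0, hL⟩ 1), 0)) (fun r p => ?_) ?_
  · simp only [Matrix.mul_apply, Matrix.transpose_apply, Matrix.of_apply]
    intro x _
    refine Finset.analyticAt_fun_sum _ fun j _ => AnalyticAt.mul ?_ ?_
    · exact Finset.analyticAt_fun_sum _ fun i _ =>
        analyticAt_const.mul (analyticAt_factorSpace_fst x r i j)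
    · exact Finset.analyticAt_fun_sum _ fun i _ =>
        analyticAt_const.mul (analyticAt_factorSpace_snd_fst x r i j)
  · have := (Pi.basisFun ℝ (Fin IH × Fin JH)).linearIndependent.comp _ e.injective
    convert this using 2 with r
    ext p
    have h1 : ∀ M : Matrix (Fin IM) (Fin L) ℝ, Matrix.of (M : Fin IM → Fin L → ℝ) = M :=
      fun _ => rfl
    have h2 : ∀ M : Matrix (Fin JM) (Fin L) ℝ, Matrix.of (M : Fin JM → Fin L → ℝ) = M :=
      fun _ => rfl
    simp only [h1, h2, Matrix.mul_vecMulVec, hu, hw, Matrix.transpose_vecMulVec]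
    rcases p with ⟨i, j⟩
    simp [Matrix.vecMulVec_apply, Pi.single_apply, Prod.ext_iff, ite_and]
    split_ifs <;> rfl

/-- The deterministic core: the MSI fixes the blocks up to `π` and `a`, and `hli` then lets the HSI
fix the columns of `C'`. -/
theorem ll1Tensor_eq_of_isCoupledLL1Solution {IH JH KH IM JM KM L R kA kB kC : ℕ}
    {P₁ : Matrix (Fin IH) (Fin IM) ℝ} {P₂ : Matrix (Fin JH) (Fin JM) ℝ}
    {PM : Matrix (Fin KM) (Fin KH) ℝ}
    {A A' : Fin R → Matrix (Fin IM) (Fin L) ℝ} {B B' : Fin R → Matrix (Fin JM) (Fin L) ℝ}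
    {C C' : Matrix (Fin KH) (Fin R) ℝ} (hL : 0 < L)
    (hA : BlockKruskalRankGE kA A) (hB : BlockKruskalRankGE kB B)
    (hC : KruskalRankGE kC (PM * C).col) (hkA : kA ≤ R) (hkB : kB ≤ R) (hkC : kC ≤ R)
    (hk : 2 * R + 2 ≤ kA + kB + kC)
    (hli : LinearIndependent ℝ (fun (r : Fin R) (p : Fin IH × Fin JH) =>
        (P₁ * A r * (P₂ * B r)ᵀ) p.1 p.2))
    (h : IsCoupledLL1Solution P₁ P₂ PM (ll1Tensor (fun r => P₁ * A r) (fun r => P₂ * B r) C)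
      (ll1Tensor A B (PM * C)) A' B' C') :
    ll1Tensor A B C = ll1Tensor A' B' C' := by
  obtain ⟨π, a, ha, hπ⟩ := exists_perm_of_block_term_eq (c' := (PM * C').col)
    (S' := fun r => A' r * (B' r)ᵀ) (by simpa using hL) hA hB hC
    (by simpa using hkA) (by simpa using hkB) (by simpa using hkC) (by simpa using hk)
    (fun r => (Matrix.rank_mul_le_left _ _).trans (Matrix.rank_le_card_width _)) (by
      intro i j
      ext k
      have := congrFun (congrFun (congrFun h.msi i) j) k
      simpa only [ll1Tensor_apply, Matrix.col_apply, Finset.sum_apply, Pi.smul_apply,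
        smul_eq_mul] using this)
  have hS : ∀ r, A' r * (B' r)ᵀ = (a r)⁻¹ • (A (π r) * (B (π r))ᵀ) := fun r => by
    rw [← hπ r, smul_smul, inv_mul_cancel₀ (ha r), one_smul]
  have hH : ∀ r, P₁ * A' r * (P₂ * B' r)ᵀ = (a r)⁻¹ • (P₁ * A (π r) * (P₂ * B (π r))ᵀ) := by
    intro r
    have : ∀ (X : Matrix (Fin IM) (Fin L) ℝ) (Y : Matrix (Fin JM) (Fin L) ℝ),
        P₁ * X * (P₂ * Y)ᵀ = P₁ * (X * Yᵀ) * P₂ᵀ := by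
      intro X Y
      rw [Matrix.transpose_mul]
      simp only [Matrix.mul_assoc]
    rw [this, this, hS, Matrix.mul_smul, Matrix.smul_mul]
  -- For each band `k`, both expansions of the HSI slice use the independent degraded true blocks,
  -- so their coefficients agree.
  have hCC : ∀ k r, C k (π r) = (a r)⁻¹ * C' k r := by
    intro k
    have h0 := Fintype.linearIndependent_iff.1 hli
      (fun s => C k s - (a (π.symm s))⁻¹ * C' k (π.symm s)) (by
        ext ⟨i, j⟩
        have h1 := congrFun (congrFun (congrFun h.hsi i) j) k
        simp only [ll1Tensor_apply, hH, Matrix.smul_apply, smul_eq_mul] at h1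
        rw [Finset.sum_apply]
        simp only [Pi.smul_apply, smul_eq_mul, sub_mul, Finset.sum_sub_distrib, Pi.zero_apply]
        rw [sub_eq_zero, ← Equiv.sum_comp π fun s => (a (π.symm s))⁻¹ * C' k (π.symm s) *
          (P₁ * A s * (P₂ * B s)ᵀ) i j]
        simp only [Equiv.symm_apply_apply]
        rw [Finset.sum_congr rfl fun r _ => mul_comm (C k r) _, h1]
        exact Finset.sum_congr rfl fun r _ => by ring)
    intro r
    have := h0 (π r)
    rw [Equiv.symm_apply_apply, sub_eq_zero] at this
    exact this
  ext i j k
  rw [ll1Tensor_apply, ll1Tensor_apply, ← Equiv.sum_comp π]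
  refine Finset.sum_congr rfl fun r _ => ?_
  rw [hS, hCC, Matrix.smul_apply, smul_eq_mul]
  ring

theorem theorem1 {Ω : Type*} [MeasurableSpace Ω] (ℙ : Measure Ω) [IsProbabilityMeasure ℙ]
    (IH JH KH IM JM KM L R : ℕ)
    -- the degradation matrices, all of full row rank
    (P₁ : Matrix (Fin IH) (Fin IM) ℝ) (P₂ : Matrix (Fin JH) (Fin JM) ℝ)
    (PM : Matrix (Fin KM) (Fin KH) ℝ)
    (hP₁ : P₁.rank = IH) (hP₂ : P₂.rank = JH) (hPM : PM.rank = KM)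
    -- the random ground-truth factors, with an absolutely continuous joint law
    (A : Ω → Fin R → Matrix (Fin IM) (Fin L) ℝ) (B : Ω → Fin R → Matrix (Fin JM) (Fin L) ℝ)
    (C : Ω → Matrix (Fin KH) (Fin R) ℝ)
    (hmeas : AEMeasurable (fun ω => factorPoint (A ω) (B ω) (C ω)) ℙ)
    (hac : ℙ.map (fun ω => factorPoint (A ω) (B ω) (C ω)) ≪ volume)
    -- the SRI follows the LL1 model; the HSI and the MSI follow the degradation models
    (YS : Ω → Tensor3 IM JM KH) (YH : Ω → Tensor3 IH JH KH) (YM : Ω → Tensor3 IM JM KM)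
    (hYS : ∀ ω, YS ω = ll1Tensor (A ω) (B ω) (C ω))
    (hYH : ∀ ω, YH ω = ll1Tensor (fun r => P₁ * A ω r) (fun r => P₂ * B ω r) (C ω))
    (hYM : ∀ ω, YM ω = ll1Tensor (A ω) (B ω) (PM * C ω))
    -- the dimension conditions
    (hM : L ^ 2 * R ≤ IM * JM) (hH : L * R ≤ IH * JH)
    (hK : 2 * R + 2 ≤ min (IM / L) R + min (JM / L) R + min KM R) :
    ∀ᵐ ω ∂ℙ, ∀ (A' : Fin R → Matrix (Fin IM) (Fin L) ℝ) (B' : Fin R → Matrix (Fin JM) (Fin L) ℝ)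
      (C' : Matrix (Fin KH) (Fin R) ℝ),
      IsCoupledLL1Solution P₁ P₂ PM (YH ω) (YM ω) A' B' C' → YS ω = ll1Tensor A' B' C' := by
  -- For `L = 0` the quotients `IM / L` and `JM / L` are 0 in `ℕ`, and `hK` would give `2 * R + 2 ≤
  -- R`.
  have hL : 0 < L := by
    rcases Nat.eq_zero_or_pos L with rfl | h
    · simp at hK; omega
    · exact h
  have hA : ∀ᵐ x : FactorSpace IM JM KH L R,
      BlockKruskalRankGE (min (IM / L) R) (fun r => Matrix.of (x.1 r)) := by
    refine ae_blockKruskalRankGE (E := FactorSpace IM JM KH L R) volume (fun r i j x _ => ?_)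
      (fun M => ⟨(fun r => M r, 0, 0), rfl⟩) ?_
    · simp only [Matrix.of_apply]
      exact analyticAt_factorSpace_fst x r i j
    · simpa using (Nat.mul_le_mul_right L (min_le_left _ R)).trans (Nat.div_mul_le_self IM L)
  have hB : ∀ᵐ x : FactorSpace IM JM KH L R,
      BlockKruskalRankGE (min (JM / L) R) (fun r => Matrix.of (x.2.1 r)) := by
    refine ae_blockKruskalRankGE (E := FactorSpace IM JM KH L R) volume (fun r i j x _ => ?_)
      (fun M => ⟨(0, fun r => M r, 0), rfl⟩) ?_
    · simp only [Matrix.of_apply]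
      exact analyticAt_factorSpace_snd_fst x r i j
    · simpa using (Nat.mul_le_mul_right L (min_le_left _ R)).trans (Nat.div_mul_le_self JM L)
  have hC : ∀ᵐ x : FactorSpace IM JM KH L R,
      KruskalRankGE (min KM R) (PM * Matrix.of x.2.2).col := by
    refine ae_kruskalRankGE (E := FactorSpace IM JM KH L R) volume
      (fun r k x _ => ?_) (fun M => ?_) (by simp)
    · simp only [Matrix.col_apply, Matrix.mul_apply, Matrix.of_apply]
      exact Finset.analyticAt_fun_sum _ fun i _ =>
        analyticAt_const.mul (analyticAt_factorSpace_snd_snd x i r)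
    · choose w hw using fun r =>
        Matrix.mulVec_surjective_of_rank_eq (by simpa using hPM) (M r)
      refine ⟨(0, 0, fun k r => w r k), ?_⟩
      ext r k
      rw [← hw r]
      rfl
  have hR : R ≤ IH * JH := (Nat.le_mul_of_pos_left R hL).trans hH
  have hli := ae_linearIndependent_degraded (KH := KH) hP₁ hP₂ hL hR
  -- Absolute continuity transfers the Lebesgue-generic properties to the law of the factors.
  filter_upwards [ae_of_ae_map hmeas (hac.ae_le (hA.and (hB.and (hC.and hli))))] with ω hω
  obtain ⟨h1, h2, h3, h4⟩ := hω
  intro A' B' C' h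
  rw [hYH, hYM] at h
  rw [hYS]
  exact ll1Tensor_eq_of_isCoupledLL1Solution hL h1 h2 h3 (min_le_right _ _) (min_le_right _ _)
    (min_le_right _ _) hK h4 h
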